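/- For an integer $n\ge 0$ and real $a\ge 0$ let $w(x,a)=e^{-x^2}\bigl(1-\chi_{(-a,a)}(x)\bigr)$, $x\in\mathbb R$, where $\chi_{(-a,a)}$ is the characteristic function of the interval $(-a,a)$, and let $$D_n(a)=\det\Bigl(\int_{\mathbb R}x^{i+j}w(x,a)\,dx\Bigr)_{i,j=0}^{n-1},\qquad D_0(a)=1 .$$ Let $$\mathbb P(a,n)=\frac{\int_{\mathbb R^n}\frac1{n!}\prod_{1\le i<j\le n}(x_j-x_i)^2\prod_{k=1}^n w(x_k,a)\,dx_k}{\int_{\mathbb R^n}\frac1{n!}\prod_{1\le i<j\le n}(x_j-x_i)^2\prod_{k=1}^n e^{-x_k^2}\,dx_k}$$ be the probability that $(-a,a)$ contains no eigenvalue in the $n\times n$ Gaussian unitary ensemble. Then $D_n(a)>0$ and $\mathbb P(a,n)=D_n(a)/D_n(0)$ for all $a\ge0$, the function $D_n$ is differentiable on $(0,\infty)$, and the function $$\sigma_n(a):=a\frac{d}{da}\log D_n(a)=a\frac{d}{da}\log\mathbb P(a,n)\qquad(a>0)$$ is infinitely differentiable on $(0,\infty)$. Moreover: (i) For every $a>0$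 and every $n\ge1$, writing $\sigma_m=\sigma_m(a)$, $$\begin{aligned}&\Bigl[(\sigma_{n-1}-\sigma_n)(\sigma_n-\sigma_{n+1}-2a^2)\bigl((\sigma_{n-1}-\sigma_n-2a^2)(\sigma_n-\sigma_{n+1})+4na^2\bigr)-8a^4\bigl(\sigma_n+n(\sigma_n-\sigma_{n+1})\bigr)\Bigr]^2\\&=(\sigma_{n-1}-\sigma_n)(\sigma_n-\sigma_{n+1})(\sigma_{n-1}-\sigma_n-2a^2)^2(\sigma_n-\sigma_{n+1}-2a^2)^2\bigl((\sigma_{n-1}-\sigma_n)(\sigma_n-\sigma_{n+1})+8na^2\bigr).\end{aligned}$$ (ii) For every $n\ge0$ and every $a>0$, with $\sigma_n,\sigma_n',\sigma_n''$ evaluated at $a$, $$\begin{aligned}&16\Bigl[a^2\sigma_n''+4(\sigma_n+2na^2)(a\sigma_n'-\sigma_n-a^4)-4a^4\Bigr]\Bigl[a^4(\sigma_n'')^2-4a^2\sigma_n''(a\sigma_n'-\sigma_n)+4(a\sigma_n'-\sigma_n-a^4)(a\sigma_n'-2\sigma_n)^2\Bigr]\\&=\Bigl[a^2(\sigma_n'')^2+4\bigl((\sigma_n')^2+8n(a\sigma_n'-\sigma_n)-4a^2\bigr)(a\sigma_n'-\sigma_n-a^4)-16a^6\Bigr]^2.\end{aligned}$$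 -/

import Mathlib

open MeasureTheory
open scoped ContDiff

noncomputable section

namespace GUEGap

/-- The Gaussian weight with the gap `(-a, a)` removed: `w(x,a) = exp(-x^2) (1 - χ_{(-a,a)}(x))`. -/
def weight (a x : ℝ) : ℝ :=
  Real.exp (-x ^ 2) * (1 - (Set.Ioo (-a) a).indicator (fun _ => (1 : ℝ)) x)

/-- The Hankel determinant `D_n(a) = det (∫ x^(i+j) w(x,a) dx)`, `0 ≤ i, j ≤ n-1`
(so that `D_0 = 1`). -/
def hankel (n : ℕ) (a : ℝ) : ℝ :=
  (Matrix.of fun i j : Fin n => ∫ x : ℝ, x ^ ((i : ℕ) + (j : ℕ)) * weight a x).det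

/-- The `n`-fold integral `(1/n!) ∫ ∏_{i<j} (x_j - x_i)^2 ∏_k w(x_k,a) dx_1 ⋯ dx_n`. -/
def eigenvalueIntegral (n : ℕ) (a : ℝ) : ℝ :=
  ∫ x : Fin n → ℝ, (1 / (Nat.factorial n : ℝ)) *
    (∏ i : Fin n, ∏ j ∈ Finset.Ioi i, (x j - x i)) ^ 2 * ∏ k : Fin n, weight a (x k)

/-- The probability that `(-a, a)` is free of eigenvalues in the `n × n` Gaussian unitary ensemble.
For `a = 0` the interval is empty and the weight is `exp(-x^2)`. -/
def gapProb (n : ℕ) (a : ℝ) : ℝ :=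
  eigenvalueIntegral n a / eigenvalueIntegral n 0

/-- `σ_n(a) = a d/da log D_n(a)`. -/
def sigma (n : ℕ) (a : ℝ) : ℝ :=
  a * deriv (fun t : ℝ => Real.log (hankel n t)) a

end GUEGap

end

/-! Let P_n be the monic orthogonal polynomials of w(·,a) and h_n their square norms, so that D_n =
h_0⋯h_{n-1}. Since the weight is even, P_{n+2} = x P_{n+1} − (h_{n+1}/h_n) P_n. Integration by parts
on P_{n+1}P_n gives 2h_{n+1} = (n+1)h_n + 2e^{-a²}P_{n+1}(a)P_n(a) (`norm2_succ`). Hence h_0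
generates every h_n and P_n(a), and induction on n gives their derivatives in a
(`hasDerivAt_edge_norm2`) and their smoothness from h_0' alone.

In the variables u, R, c (`auxU`, `auxR`, `auxC`) the recursion reads R_n + R_{n+1} = u_n, c_{n+1} =
(n+1+R_{n+1})u_n, c_n u_n = 2a²R_n². As h_n' = −2e^{-a²}P_n(a)², one has σ_n = −∑_{k<n} u_k, and the
sum telescopes to a polynomial in u_n, R_n, c_n, a (`sigma_closed`).

For (i), R_n is a root of a quadratic with coefficients in u_{n-1}, u_n, while σ_n is linear in R_n
modulo that quadratic; squaring eliminates R_n. For (ii), aσ' = σ + 2a²R − R² and aR' = c − (n+R)u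
express σ, σ', σ'' through u, R, c, and c u = 2a²R² is the only constraint left. -/

namespace GUEGap

open Polynomial

/-! ### Orthogonal polynomials of a symmetric positive functional -/

/-- The monic orthogonal polynomials of a symmetric functional, by the three term recurrence. -/
noncomputable def orthoPoly (L : ℝ[X] →ₗ[ℝ] ℝ) : ℕ → ℝ[X]
  | 0 => 1
  | 1 => X
  | n + 2 => X * orthoPoly L (n + 1) -
      C (L (orthoPoly L (n + 1) * orthoPoly L (n + 1)) / L (orthoPoly L n * orthoPoly L n)) *
        orthoPoly L n

/-- The square norm of the `n`-th orthogonal polynomial. -/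
noncomputable def sqNorm (L : ℝ[X] →ₗ[ℝ] ℝ) (n : ℕ) : ℝ := L (orthoPoly L n * orthoPoly L n)

theorem orthoPoly_add_two (L : ℝ[X] →ₗ[ℝ] ℝ) (n : ℕ) :
    orthoPoly L (n + 2) =
      X * orthoPoly L (n + 1) - C (sqNorm L (n + 1) / sqNorm L n) * orthoPoly L n := by
  rw [orthoPoly]; rfl

theorem orthoPoly_monic_degree (L : ℝ[X] →ₗ[ℝ] ℝ) (n : ℕ) :
    ((orthoPoly L n).Monic ∧ (orthoPoly L n).degree = n) ∧
      ((orthoPoly L (n + 1)).Monic ∧ (orthoPoly L (n + 1)).degree = ((n + 1 : ℕ) : WithBot ℕ)) := by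
  induction n with
  | zero => exact ⟨⟨by simp [orthoPoly], by simp [orthoPoly]⟩, by simp [orthoPoly, monic_X], by
      simp [orthoPoly]⟩
  | succ n ih =>
    obtain ⟨⟨hm, hd⟩, hm', hd'⟩ := ih
    refine ⟨⟨hm', hd'⟩, ?_⟩
    have hX : (X * orthoPoly L (n + 1)).degree = ((n + 2 : ℕ) : WithBot ℕ) := by
      rw [degree_mul, degree_X, hd']; norm_cast; omega
    have hlt : (C (sqNorm L (n + 1) / sqNorm L n) * orthoPoly L n).degree
        < (X * orthoPoly L (n + 1)).degree := by
      rw [hX]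
      rw [← smul_eq_C_mul]
      refine (degree_smul_le _ _).trans_lt ?_
      rw [hd]; norm_cast; omega
    rw [orthoPoly_add_two]
    exact ⟨(monic_X.mul hm').sub_of_left hlt, by rw [degree_sub_eq_left_of_degree_lt hlt, hX]⟩

theorem orthoPoly_monic (L : ℝ[X] →ₗ[ℝ] ℝ) (n : ℕ) : (orthoPoly L n).Monic :=
  (orthoPoly_monic_degree L n).1.1

theorem orthoPoly_degree (L : ℝ[X] →ₗ[ℝ] ℝ) (n : ℕ) : (orthoPoly L n).degree = n :=
  (orthoPoly_monic_degree L n).1.2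

theorem orthoPoly_natDegree (L : ℝ[X] →ₗ[ℝ] ℝ) (n : ℕ) : (orthoPoly L n).natDegree = n :=
  natDegree_eq_of_degree_eq_some (orthoPoly_degree L n)

theorem orthoPoly_comp_neg (L : ℝ[X] →ₗ[ℝ] ℝ) (n : ℕ) :
    (orthoPoly L n).comp (-X) = (-1) ^ n * orthoPoly L n ∧
      (orthoPoly L (n + 1)).comp (-X) = (-1) ^ (n + 1) * orthoPoly L (n + 1) := by
  induction n with
  | zero => simp [orthoPoly]
  | succ n ih =>
    refine ⟨ih.2, ?_⟩
    rw [orthoPoly_add_two, sub_comp, mul_comp, mul_comp, ih.1, ih.2, X_comp, C_comp]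
    ring

theorem orthoPoly_eval_neg (L : ℝ[X] →ₗ[ℝ] ℝ) (n : ℕ) (x : ℝ) :
    (orthoPoly L n).eval (-x) = (-1) ^ n * (orthoPoly L n).eval x := by
  have := congrArg (eval x) (orthoPoly_comp_neg L n).1
  simpa [eval_comp] using this

/-- A symmetric positive definite functional on real polynomials. -/
structure SymmPos (L : ℝ[X] →ₗ[ℝ] ℝ) : Prop where
  comp_neg : ∀ p : ℝ[X], L (p.comp (-X)) = L p
  pos : ∀ p : ℝ[X], p ≠ 0 → 0 < L (p * p)

variable {L : ℝ[X] →ₗ[ℝ] ℝ}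

theorem SymmPos.sqNorm_pos (hL : SymmPos L) (n : ℕ) : 0 < sqNorm L n :=
  hL.pos _ (orthoPoly_monic L n).ne_zero

theorem SymmPos.apply_X_mul_sq (hL : SymmPos L) (n : ℕ) :
    L (X * orthoPoly L n * orthoPoly L n) = 0 := by
  have h := hL.comp_neg (X * orthoPoly L n * orthoPoly L n)
  have h2 : (X * orthoPoly L n * orthoPoly L n).comp (-X) =
      -(X * orthoPoly L n * orthoPoly L n) := by
    rw [mul_comp, mul_comp, (orthoPoly_comp_neg L n).1, X_comp]
    have : ((-1 : ℝ[X]) ^ n) * (-1) ^ n = 1 := by rw [← mul_pow]; simp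
    linear_combination (-X * orthoPoly L n * orthoPoly L n) * this
  rw [h2, map_neg] at h
  linarith

theorem degree_sub_coeff_smul_lt {p q : ℝ[X]} {n : ℕ} (hp : p.Monic) (hpd : p.degree = n)
    (hq : q.degree < (n + 1 : ℕ)) : (q - q.coeff n • p).degree < n := by
  have hc : p.coeff n = 1 := by
    have := hp.coeff_natDegree
    rwa [natDegree_eq_of_degree_eq_some hpd] at this
  rw [degree_lt_iff_coeff_zero] at hq ⊢
  intro m hm
  rcases hm.eq_or_lt with rfl | hm
  · simp [hc]
  · have : p.coeff m = 0 := coeff_eq_zero_of_degree_lt (by rw [hpd]; exact_mod_cast hm)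
    simp [this, hq m hm]

/-- The recurrence reaches back two steps, so two consecutive indices are carried. P_{n+2} is
orthogonal to P_{n+1} by parity, to P_n by the choice of the recurrence coefficient, and to lower
degrees by moving X to the other factor. -/
theorem SymmPos.apply_orthoPoly_mul (hL : SymmPos L) (n : ℕ) :
    (∀ q : ℝ[X], q.degree < n → L (orthoPoly L n * q) = 0) ∧
      ∀ q : ℝ[X], q.degree < (n + 1 : ℕ) → L (orthoPoly L (n + 1) * q) = 0 := by
  induction n with
  | zero =>
    refine ⟨fun q hq => ?_, fun q hq => ?_⟩
    · have : q = 0 := by simpa [Nat.WithBot.lt_zero_iff] using hq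
      simp [this]
    · have hd := degree_sub_coeff_smul_lt (orthoPoly_monic L 0) (orthoPoly_degree L 0) hq
      have h0 : q - q.coeff 0 • orthoPoly L 0 = 0 := by
        simpa [Nat.WithBot.lt_zero_iff] using hd
      have h1 := hL.apply_X_mul_sq 0
      rw [sub_eq_zero.1 h0, mul_smul_comm, map_smul]
      simp only [orthoPoly, mul_one] at h1 ⊢
      simp [h1]
  | succ n ih =>
    refine ⟨ih.2, fun q hq => ?_⟩
    have key : ∀ q : ℝ[X], L (orthoPoly L (n + 2) * q) =
        L (orthoPoly L (n + 1) * (X * q)) -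
          sqNorm L (n + 1) / sqNorm L n * L (orthoPoly L n * q) := by
      intro q
      rw [← smul_eq_mul (sqNorm L (n + 1) / sqNorm L n), ← map_smul, ← map_sub,
        orthoPoly_add_two, smul_eq_C_mul]
      congr 1; ring
    have e1 : L (orthoPoly L (n + 2) * orthoPoly L (n + 1)) = 0 := by
      have h1 := hL.apply_X_mul_sq (n + 1)
      have h2 := ih.2 (orthoPoly L n) (by rw [orthoPoly_degree]; norm_cast; omega)
      rw [key, mul_comm (orthoPoly L n), h2, show orthoPoly L (n + 1) * (X * orthoPoly L (n + 1)) =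
        X * orthoPoly L (n + 1) * orthoPoly L (n + 1) by ring, h1]
      ring
    have e2 : L (orthoPoly L (n + 2) * orthoPoly L n) = 0 := by
      have hd : (X * orthoPoly L n - orthoPoly L (n + 1)).degree < ((n + 1 : ℕ) : WithBot ℕ) := by
        have hXd : (X * orthoPoly L n).degree = ((n + 1 : ℕ) : WithBot ℕ) := by
          rw [degree_mul, degree_X, orthoPoly_degree]; norm_cast; omega
        rw [← hXd]
        exact degree_sub_lt_left (by rw [hXd, orthoPoly_degree])
          (mul_ne_zero X_ne_zero (orthoPoly_monic L n).ne_zero)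
          (by rw [(monic_X.mul (orthoPoly_monic L n)).leadingCoeff,
            (orthoPoly_monic L (n + 1)).leadingCoeff])
      have h1 := ih.2 _ hd
      rw [mul_sub, map_sub] at h1
      rw [key, sub_eq_zero.1 h1]
      change sqNorm L (n + 1) - sqNorm L (n + 1) / sqNorm L n * sqNorm L n = 0
      rw [div_mul_cancel₀ _ (hL.sqNorm_pos n).ne', sub_self]
    have hd1 := degree_sub_coeff_smul_lt (orthoPoly_monic L (n + 1)) (orthoPoly_degree L (n + 1)) hq
    set q1 := q - q.coeff (n + 1) • orthoPoly L (n + 1) with hq1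
    have hd2 := degree_sub_coeff_smul_lt (orthoPoly_monic L n) (orthoPoly_degree L n) hd1
    set q2 := q1 - q1.coeff n • orthoPoly L n with hq2
    have hq : q = q.coeff (n + 1) • orthoPoly L (n + 1) + (q1.coeff n • orthoPoly L n + q2) := by
      rw [hq2, hq1]; ring
    have e3 : L (orthoPoly L (n + 2) * q2) = 0 := by
      rw [key, ih.1 q2 hd2, ih.2 (X * q2), mul_zero, sub_zero]
      rw [degree_mul, degree_X]
      push_cast
      rw [add_comm]
      exact WithBot.add_lt_add_right (by simp) hd2
    rw [hq, mul_add, mul_add, mul_smul_comm, mul_smul_comm, map_add, map_add, map_smul, map_smul,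
      e1, e2, e3]
    simp

theorem SymmPos.apply_orthoPoly_mul_of_lt (hL : SymmPos L) {n : ℕ} {q : ℝ[X]}
    (hq : q.degree < n) : L (orthoPoly L n * q) = 0 :=
  (hL.apply_orthoPoly_mul n).1 q hq

theorem SymmPos.apply_orthoPoly_mul_orthoPoly (hL : SymmPos L) {m n : ℕ} (h : m ≠ n) :
    L (orthoPoly L m * orthoPoly L n) = 0 := by
  rcases h.lt_or_gt with h | h
  · rw [mul_comm]
    exact hL.apply_orthoPoly_mul_of_lt (by rw [orthoPoly_degree]; exact_mod_cast h)
  · exact hL.apply_orthoPoly_mul_of_lt (by rw [orthoPoly_degree]; exact_mod_cast h)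

/-- `L (P_{n+1}' P_n) = (n + 1) h_n`. -/
theorem SymmPos.apply_derivative_mul (hL : SymmPos L) (n : ℕ) :
    L (derivative (orthoPoly L (n + 1)) * orthoPoly L n) = (n + 1) * sqNorm L n := by
  have hd : (derivative (orthoPoly L (n + 1))).degree < (n + 1 : ℕ) := by
    rw [← orthoPoly_degree L (n + 1)]
    exact degree_derivative_lt (orthoPoly_monic L (n + 1)).ne_zero
  have h1 := hL.apply_orthoPoly_mul_of_lt
    (degree_sub_coeff_smul_lt (orthoPoly_monic L n) (orthoPoly_degree L n) hd)
  have hc : (derivative (orthoPoly L (n + 1))).coeff n = n + 1 := by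
    have := (orthoPoly_monic L (n + 1)).coeff_natDegree
    rw [orthoPoly_natDegree] at this
    rw [coeff_derivative, this, one_mul]
  rw [hc, mul_sub, mul_smul_comm, map_sub, map_smul, sub_eq_zero] at h1
  rw [mul_comm, h1]; rfl

theorem SymmPos.apply_X_mul_mul (hL : SymmPos L) (n : ℕ) :
    L (X * (orthoPoly L (n + 1) * orthoPoly L n)) = sqNorm L (n + 1) := by
  have h : X * (orthoPoly L (n + 1) * orthoPoly L n) = orthoPoly L (n + 1) * orthoPoly L (n + 1) +
      orthoPoly L (n + 1) * (X * orthoPoly L n - orthoPoly L (n + 1)) := by ring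
  suffices hd : (X * orthoPoly L n - orthoPoly L (n + 1)).degree < ((n + 1 : ℕ) : WithBot ℕ) by
    rw [h, map_add, hL.apply_orthoPoly_mul_of_lt hd, add_zero]; rfl
  cases n with
  | zero => simp [orthoPoly]
  | succ n =>
    rw [orthoPoly_add_two, sub_sub_cancel]
    rw [← smul_eq_C_mul]
    refine (degree_smul_le _ _).trans_lt ?_
    rw [orthoPoly_degree]; norm_cast; omega

/-- The Hankel determinant is the product of the square norms. -/
theorem SymmPos.det_hankel (hL : SymmPos L) (n : ℕ) :
    (Matrix.of fun i j : Fin n => L (X ^ ((i : ℕ) + (j : ℕ)))).det =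
      ∏ k ∈ Finset.range n, sqNorm L k := by
  set M : Matrix (Fin n) (Fin n) ℝ := Matrix.of fun i j => L (X ^ ((i : ℕ) + (j : ℕ))) with hM
  set A : Matrix (Fin n) (Fin n) ℝ := Matrix.of fun i j => (orthoPoly L j).coeff i with hA
  have hdet : A.det = 1 := Matrix.det_matrixOfPolynomials (fun i : Fin n => orthoPoly L i)
    (fun i => orthoPoly_natDegree L i) (fun i => orthoPoly_monic L i)
  have hsum : ∀ k : Fin n, orthoPoly L k = ∑ i : Fin n, (orthoPoly L k).coeff i • X ^ (i : ℕ) := by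
    intro k
    conv_lhs => rw [as_sum_range' (orthoPoly L k) n (by rw [orthoPoly_natDegree]; exact k.2)]
    rw [Finset.sum_range]
    simp [← C_mul_X_pow_eq_monomial, smul_eq_C_mul]
  -- A is the unitriangular change of basis from monomials to the P_k, so this is the Gram matrix in
  -- the orthogonal basis.
  have hprod : A.transpose * M * A = Matrix.diagonal fun k : Fin n => sqNorm L k := by
    ext k l
    have : L (orthoPoly L k * orthoPoly L l) = (A.transpose * M * A) k l := by
      rw [hsum k, hsum l, Finset.sum_mul_sum]
      simp only [Matrix.mul_apply, map_sum, Matrix.transpose_apply, hA, hM, Matrix.of_apply,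
        Finset.sum_mul]
      rw [Finset.sum_comm]
      refine Finset.sum_congr rfl fun i _ => Finset.sum_congr rfl fun j _ => ?_
      rw [smul_mul_smul_comm, map_smul, ← pow_add, smul_eq_mul]
      ring
    rw [← this, Matrix.diagonal_apply]
    split_ifs with h
    · subst h; rfl
    · exact hL.apply_orthoPoly_mul_orthoPoly (fun h' => h (Fin.ext h'))
  have := congrArg Matrix.det hprod
  rw [Matrix.det_mul, Matrix.det_mul, Matrix.det_transpose, hdet, Matrix.det_diagonal, one_mul,
    mul_one] at this
  rw [this, Finset.prod_range]

end GUEGap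

/-! ### The gap weight: positivity, integration by parts, Andréief's identity -/

namespace GUEGap

open Polynomial

theorem weight_eq_indicator (a x : ℝ) :
    weight a x = (Set.Ioo (-a) a)ᶜ.indicator (fun x => Real.exp (-x ^ 2)) x := by
  unfold weight
  by_cases h : x ∈ Set.Ioo (-a) a <;> simp [h]

theorem weight_nonneg (a x : ℝ) : 0 ≤ weight a x := by
  rw [weight_eq_indicator]
  exact Set.indicator_nonneg (fun _ _ => (Real.exp_pos _).le) x

theorem weight_neg (a x : ℝ) : weight a (-x) = weight a x := by
  have : -x ∈ Set.Ioo (-a) a ↔ x ∈ Set.Ioo (-a) a := by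
    simp only [Set.mem_Ioo]
    constructor <;> rintro ⟨h1, h2⟩ <;> constructor <;> linarith
  by_cases h : x ∈ Set.Ioo (-a) a <;> simp [weight, this, h]

theorem integrable_eval_mul_gaussian (p : ℝ[X]) :
    Integrable fun x : ℝ => p.eval x * Real.exp (-x ^ 2) := by
  induction p using Polynomial.induction_on' with
  | add p q hp hq =>
    simp only [eval_add, add_mul]
    exact hp.add hq
  | monomial n c =>
    have := integrable_rpow_mul_exp_neg_mul_sq one_pos (s := n) (by
      have : (0 : ℝ) ≤ n := n.cast_nonneg
      linarith)
    simpa [mul_assoc] using this.const_mul c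

theorem hasDerivAt_gaussian (x : ℝ) :
    HasDerivAt (fun x : ℝ => Real.exp (-x ^ 2)) (-2 * x * Real.exp (-x ^ 2)) x := by
  convert! (hasDerivAt_pow 2 x).neg.exp using 1
  simp
  ring

theorem eval_mul_weight (p : ℝ[X]) (a x : ℝ) : p.eval x * weight a x =
    (Set.Ioo (-a) a)ᶜ.indicator (fun x => p.eval x * Real.exp (-x ^ 2)) x := by
  rw [weight_eq_indicator]
  by_cases h : x ∈ Set.Ioo (-a) a <;> simp [h]

theorem integrable_eval_mul_weight (a : ℝ) (p : ℝ[X]) :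
    Integrable fun x : ℝ => p.eval x * weight a x := by
  simp_rw [eval_mul_weight]
  exact (integrable_eval_mul_gaussian p).indicator measurableSet_Ioo.compl

/-- Integration of polynomials against `w(x,a)`. -/
noncomputable def gapFunctional (a : ℝ) : ℝ[X] →ₗ[ℝ] ℝ where
  toFun p := ∫ x : ℝ, p.eval x * weight a x
  map_add' p q := by
    simp only [eval_add, add_mul]
    exact integral_add (integrable_eval_mul_weight a p) (integrable_eval_mul_weight a q)
  map_smul' c p := by
    simp only [eval_smul, smul_eq_mul, mul_assoc, RingHom.id_apply]
    exact integral_const_mul c _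

theorem gapFunctional_apply (a : ℝ) (p : ℝ[X]) :
    gapFunctional a p = ∫ x : ℝ, p.eval x * weight a x := rfl

theorem gapFunctional_symmPos (a : ℝ) : SymmPos (gapFunctional a) where
  comp_neg p := by
    rw [gapFunctional_apply, gapFunctional_apply,
      ← integral_neg_eq_self (fun x => p.eval x * weight a x)]
    simp [eval_comp, weight_neg]
  pos p hp := by
    rw [gapFunctional_apply, integral_pos_iff_support_of_nonneg _ (integrable_eval_mul_weight a _)]
    -- To the right of the gap the integrand vanishes only at the finitely many roots of p.
    · refine lt_of_lt_of_le (b := volume (Set.Ioi a \ (p.roots.toFinset : Set ℝ))) ?_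
        (measure_mono ?_)
      · rw [measure_sdiff_null (p.roots.toFinset.finite_toSet.measure_zero volume)]
        simp
      · rintro x ⟨hx, hx'⟩
        have hx0 : p.eval x ≠ 0 := by simpa [hp] using hx'
        have hx1 : x ∉ Set.Ioo (-a) a := fun h => lt_asymm h.2 hx
        simp [weight, hx0, hx1]
    · intro x
      simp only [eval_mul]
      exact mul_nonneg (mul_self_nonneg _) (weight_nonneg a x)

/-- The square norm `h_n(a)` of the `n`-th monic orthogonal polynomial for `w(x,a)`. -/
noncomputable def norm2 (n : ℕ) (a : ℝ) : ℝ := sqNorm (gapFunctional a) n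

/-- The value `P_n(a;a)` of the `n`-th monic orthogonal polynomial at the edge of the gap. -/
noncomputable def edge (n : ℕ) (a : ℝ) : ℝ := (orthoPoly (gapFunctional a) n).eval a

theorem norm2_pos (n : ℕ) (a : ℝ) : 0 < norm2 n a :=
  (gapFunctional_symmPos a).sqNorm_pos n

theorem hankel_eq_prod (n : ℕ) (a : ℝ) :
    hankel n a = ∏ k ∈ Finset.range n, norm2 k a := by
  simp only [norm2]
  rw [← (gapFunctional_symmPos a).det_hankel]
  simp [hankel, gapFunctional_apply]

theorem hankel_pos (n : ℕ) (a : ℝ) : 0 < hankel n a := by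
  rw [hankel_eq_prod n a]
  exact Finset.prod_pos fun k _ => norm2_pos k a

theorem gapFunctional_eq_sub {a : ℝ} (ha : 0 ≤ a) (p : ℝ[X]) :
    gapFunctional a p = (∫ x : ℝ, p.eval x * Real.exp (-x ^ 2)) -
      ∫ x in (-a)..a, p.eval x * Real.exp (-x ^ 2) := by
  have h := integral_add_compl (measurableSet_Ioo (a := -a) (b := a))
    (integrable_eval_mul_gaussian p)
  rw [gapFunctional_apply]
  simp_rw [eval_mul_weight]
  rw [integral_indicator measurableSet_Ioo.compl, ← h,
    intervalIntegral.integral_of_le (by linarith), integral_Ioc_eq_integral_Ioo]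
  ring

/-- Integration by parts against the weight; the jumps at `±a` give the boundary terms. -/
theorem gapFunctional_derivative {a : ℝ} (ha : 0 ≤ a) (p : ℝ[X]) :
    gapFunctional a (derivative p) - 2 * gapFunctional a (X * p) =
      -Real.exp (-a ^ 2) * (p.eval a - p.eval (-a)) := by
  have h1 : gapFunctional a (derivative p) - 2 * gapFunctional a (X * p) =
      gapFunctional a (derivative p - C 2 * (X * p)) := by
    rw [map_sub, ← smul_eq_C_mul, map_smul, smul_eq_mul]
  have hd : ∀ x : ℝ, HasDerivAt (fun x => p.eval x * Real.exp (-x ^ 2))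
      ((derivative p - C 2 * (X * p)).eval x * Real.exp (-x ^ 2)) x := by
    intro x
    convert! (p.hasDerivAt x).mul (hasDerivAt_gaussian x) using 1
    simp
    ring
  rw [h1, gapFunctional_eq_sub ha, integral_eq_zero_of_hasDerivAt_of_integrable hd
    (integrable_eval_mul_gaussian _) (integrable_eval_mul_gaussian _),
    intervalIntegral.integral_eq_sub_of_hasDerivAt (fun x _ => hd x)
    (integrable_eval_mul_gaussian _).intervalIntegrable]
  simp
  ring

theorem edge_zero (a : ℝ) : edge 0 a = 1 := by simp [edge, orthoPoly]

theorem edge_one (a : ℝ) : edge 1 a = a := by simp [edge, orthoPoly]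

theorem edge_add_two (n : ℕ) (a : ℝ) :
    edge (n + 2) a = a * edge (n + 1) a - norm2 (n + 1) a / norm2 n a * edge n a := by
  simp [edge, norm2, orthoPoly_add_two]

/-- Integration by parts for P_{n+1}P_n. Orthogonality kills P_{n+1}P_n', and since P_{n+1}P_n is
odd the boundary terms at ±a add up. -/
theorem norm2_succ {a : ℝ} (ha : 0 ≤ a) (n : ℕ) :
    norm2 (n + 1) a =
      ((n + 1) * norm2 n a + 2 * Real.exp (-a ^ 2) * edge (n + 1) a * edge n a) / 2 := by
  have hL := gapFunctional_symmPos a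
  set L := gapFunctional a
  have h := gapFunctional_derivative ha (orthoPoly L (n + 1) * orthoPoly L n)
  have h2 : L (orthoPoly L (n + 1) * derivative (orthoPoly L n)) = 0 := by
    refine hL.apply_orthoPoly_mul_of_lt (lt_of_lt_of_le
      (degree_derivative_lt (orthoPoly_monic L n).ne_zero) ?_)
    rw [orthoPoly_degree]; norm_cast; omega
  have hs : ((-1 : ℝ) ^ n) * (-1) ^ n = 1 := by rw [← mul_pow]; simp
  rw [derivative_mul, map_add, h2, hL.apply_derivative_mul, hL.apply_X_mul_mul, eval_mul, eval_mul,
    orthoPoly_eval_neg, orthoPoly_eval_neg] at h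
  simp only [norm2, edge]
  linear_combination (-1 / 2) * h + Real.exp (-a ^ 2) / 2 * eval a (orthoPoly L (n + 1)) *
    eval a (orthoPoly L n) * hs

theorem hasDerivAt_norm2_zero {a : ℝ} (ha : 0 < a) :
    HasDerivAt (norm2 0) (-2 * Real.exp (-a ^ 2)) a := by
  have hc : Continuous fun x : ℝ => Real.exp (-x ^ 2) := by fun_prop
  have hF : ∀ x : ℝ, HasDerivAt (fun t => ∫ x in (0 : ℝ)..t, Real.exp (-x ^ 2))
      (Real.exp (-x ^ 2)) x := fun x => hc.integral_hasStrictDerivAt 0 x |>.hasDerivAt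
  have heq : (fun t : ℝ => (∫ x : ℝ, Real.exp (-x ^ 2)) - ((∫ x in (0 : ℝ)..t, Real.exp (-x ^ 2)) -
      ∫ x in (0 : ℝ)..(-t), Real.exp (-x ^ 2))) =ᶠ[nhds a] norm2 0 := by
    filter_upwards [eventually_gt_nhds ha] with t ht
    rw [norm2, sqNorm, gapFunctional_eq_sub ht.le, intervalIntegral.integral_interval_sub_left
      (hc.intervalIntegrable _ _) (hc.intervalIntegrable _ _)]
    simp [orthoPoly]
  refine HasDerivAt.congr_of_eventuallyEq ?_ heq.symm
  have h2 := (hF (-a)).scomp a (hasDerivAt_neg a)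
  convert! ((hF a).sub h2).const_sub (∫ x : ℝ, Real.exp (-x ^ 2)) using 1
  simp
  ring

/-- Andréief's identity: the eigenvalue integral is the Hankel determinant. -/
theorem eigenvalueIntegral_eq_hankel (n : ℕ) (a : ℝ) : eigenvalueIntegral n a = hankel n a := by
  have hint : ∀ k : ℕ, Integrable fun x : ℝ => x ^ k * weight a x := fun k => by
    simpa using integrable_eval_mul_weight a (X ^ k)
  have hexp : ∀ x : Fin n → ℝ, (1 / (Nat.factorial n : ℝ)) *
      (∏ i : Fin n, ∏ j ∈ Finset.Ioi i, (x j - x i)) ^ 2 * ∏ k : Fin n, weight a (x k) =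
      ∑ σ : Equiv.Perm (Fin n), ∑ τ : Equiv.Perm (Fin n), (1 / (Nat.factorial n : ℝ)) *
        (((Equiv.Perm.sign σ : ℤ) : ℝ) * ((Equiv.Perm.sign τ : ℤ) : ℝ)) *
        ∏ k : Fin n, x k ^ ((σ k : ℕ) + (τ k : ℕ)) * weight a (x k) := by
    intro x
    rw [← Matrix.det_vandermonde, ← Matrix.det_transpose, Matrix.det_apply', sq, Finset.sum_mul_sum,
      Finset.mul_sum, Finset.sum_mul]
    refine Finset.sum_congr rfl fun σ _ => ?_
    rw [Finset.mul_sum, Finset.sum_mul]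
    refine Finset.sum_congr rfl fun τ _ => ?_
    simp only [Matrix.transpose_apply, Matrix.vandermonde_apply, Finset.prod_mul_distrib, pow_add]
    ring
  have hI : ∀ σ τ : Equiv.Perm (Fin n), Integrable fun x : Fin n → ℝ =>
      (1 / (Nat.factorial n : ℝ)) *
        (((Equiv.Perm.sign σ : ℤ) : ℝ) * ((Equiv.Perm.sign τ : ℤ) : ℝ)) *
        ∏ k : Fin n, x k ^ ((σ k : ℕ) + (τ k : ℕ)) * weight a (x k) := fun σ τ =>
    (Integrable.fintype_prod (f := fun (k : Fin n) (t : ℝ) =>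
      t ^ ((σ k : ℕ) + (τ k : ℕ)) * weight a t) fun k => hint _).const_mul _
  set M : Matrix (Fin n) (Fin n) ℝ :=
    Matrix.of fun i j : Fin n => ∫ x : ℝ, x ^ ((i : ℕ) + (j : ℕ)) * weight a x with hM
  -- Permuting the rows by σ costs sign σ, which cancels the other sign σ; the n! equal
  -- contributions then absorb the factor 1/n!.
  have hrow : ∀ σ : Equiv.Perm (Fin n), ∑ τ : Equiv.Perm (Fin n),
      (((Equiv.Perm.sign σ : ℤ) : ℝ) * ((Equiv.Perm.sign τ : ℤ) : ℝ)) * ∏ k : Fin n, M (σ k) (τ k)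
      = M.det := by
    intro σ
    have h := Matrix.det_permute σ M
    have hs : ((Equiv.Perm.sign σ : ℤ) : ℝ) * ((Equiv.Perm.sign σ : ℤ) : ℝ) = 1 := by
      exact_mod_cast Int.units_coe_mul_self (Equiv.Perm.sign σ)
    rw [← Matrix.det_transpose, Matrix.det_apply'] at h
    simp only [mul_assoc]
    rw [← Finset.mul_sum]
    simp only [Matrix.transpose_apply, Matrix.submatrix_apply, id] at h
    rw [h, ← mul_assoc, hs, one_mul]
  unfold eigenvalueIntegral
  simp_rw [hexp]
  rw [integral_finsetSum _ fun σ _ => integrable_finsetSum _ fun τ _ => hI σ τ]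
  simp_rw [integral_finsetSum _ fun τ _ => hI _ τ, integral_const_mul]
  have hprod : ∀ σ τ : Equiv.Perm (Fin n),
      ∫ x : Fin n → ℝ, ∏ k : Fin n, x k ^ ((σ k : ℕ) + (τ k : ℕ)) * weight a (x k) =
        ∏ k : Fin n, M (σ k) (τ k) := fun σ τ =>
    integral_fintype_prod_volume_eq_prod fun (k : Fin n) (t : ℝ) =>
      t ^ ((σ k : ℕ) + (τ k : ℕ)) * weight a t
  simp_rw [hprod, mul_assoc (1 / (Nat.factorial n : ℝ)), ← Finset.mul_sum, hrow]
  have hf : (Nat.factorial n : ℝ) ≠ 0 := by exact_mod_cast n.factorial_ne_zero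
  simp [Fintype.card_perm, hankel, hf, M]

theorem gapProb_eq (n : ℕ) (a : ℝ) : gapProb n a = hankel n a / hankel n 0 := by
  rw [gapProb, eigenvalueIntegral_eq_hankel, eigenvalueIntegral_eq_hankel]

end GUEGap

/-! ### Auxiliary quantities and their algebraic relations -/

namespace GUEGap

/-- `u_n = 2a exp(-a²) P_n(a)² / h_n`, which is `σ_n - σ_{n+1}`. -/
noncomputable def auxU (n : ℕ) (a : ℝ) : ℝ :=
  2 * a * Real.exp (-a ^ 2) * edge n a ^ 2 / norm2 n a

/-- `R_n = 2 exp(-a²) P_n(a) P_{n-1}(a) / h_{n-1}`, written without the index `n - 1`. -/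
noncomputable def auxR (n : ℕ) (a : ℝ) : ℝ :=
  2 * Real.exp (-a ^ 2) * edge n a * (a * edge n a - edge (n + 1) a) / norm2 n a

/-- `c_n = 2 β_n u_{n-1}`, written without the index `n - 1`. -/
noncomputable def auxC (n : ℕ) (a : ℝ) : ℝ :=
  4 * a * Real.exp (-a ^ 2) * (a * edge n a - edge (n + 1) a) ^ 2 / norm2 n a

theorem auxR_succ (n : ℕ) (a : ℝ) :
    auxR (n + 1) a = 2 * Real.exp (-a ^ 2) * edge (n + 1) a * edge n a / norm2 n a := by
  have h0 := (norm2_pos n a).ne'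
  have h1 := (norm2_pos (n + 1) a).ne'
  rw [auxR, edge_add_two]
  field_simp
  ring

theorem auxR_add_auxR_succ (n : ℕ) (a : ℝ) : auxR n a + auxR (n + 1) a = auxU n a := by
  rw [auxR_succ, auxR, auxU]
  ring

theorem norm2_succ_eq {a : ℝ} (ha : 0 ≤ a) (n : ℕ) :
    norm2 (n + 1) a = (n + 1 + auxR (n + 1) a) * norm2 n a / 2 := by
  have h0 := (norm2_pos n a).ne'
  rw [norm2_succ ha, auxR_succ]
  field_simp

theorem auxC_succ {a : ℝ} (ha : 0 ≤ a) (n : ℕ) :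
    auxC (n + 1) a = (n + 1 + auxR (n + 1) a) * auxU n a := by
  have h0 := (norm2_pos n a).ne'
  have h1 := (norm2_pos (n + 1) a).ne'
  have h2 : (n + 1 + auxR (n + 1) a) = 2 * norm2 (n + 1) a / norm2 n a := by
    rw [norm2_succ_eq ha]; field_simp
  rw [h2, auxC, auxU, edge_add_two]
  field_simp
  ring

theorem auxC_mul_auxU (n : ℕ) (a : ℝ) : auxC n a * auxU n a = 2 * a ^ 2 * auxR n a ^ 2 := by
  rw [auxC, auxU, auxR]
  ring

/-- The left side is 4a e^{-a²}P_{n+1}(a)²/h_n; expand the square of P_{n+1} = aP_n − (aP_n −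
P_{n+1}) at a. -/
theorem mul_auxU_succ {a : ℝ} (ha : 0 ≤ a) (n : ℕ) :
    (n + 1 + auxR (n + 1) a) * auxU (n + 1) a =
      auxC n a + 2 * a ^ 2 * (auxU n a - 2 * auxR n a) := by
  have h0 := (norm2_pos n a).ne'
  have h1 := (norm2_pos (n + 1) a).ne'
  have h2 : (n + 1 + auxR (n + 1) a) = 2 * norm2 (n + 1) a / norm2 n a := by
    rw [norm2_succ_eq ha]; field_simp
  rw [h2, auxC, auxU, auxU, auxR]
  field_simp
  ring

theorem auxR_zero (a : ℝ) : auxR 0 a = 0 := by simp [auxR, edge_zero, edge_one]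

theorem auxC_zero (a : ℝ) : auxC 0 a = 0 := by simp [auxC, edge_zero, edge_one]

/-- `-∑_{k<n} u_k` in closed form. -/
theorem neg_sum_auxU {a : ℝ} (ha : 0 ≤ a) (n : ℕ) :
    -∑ k ∈ Finset.range n, auxU k a =
      -(n + auxR n a) * auxU n a - auxC n a + 2 * a ^ 2 * auxR n a + auxR n a ^ 2 := by
  induction n with
  | zero => simp [auxR_zero, auxC_zero]
  | succ n ih =>
    have hR : auxR (n + 1) a = auxU n a - auxR n a := by
      rw [← auxR_add_auxR_succ]; ring
    have hC := auxC_succ ha n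
    have hU := mul_auxU_succ ha n
    rw [Finset.sum_range_succ, neg_add, ih]
    push_cast
    rw [hR] at hU hC ⊢
    linear_combination hU + hC

/-! ### Derivatives in a -/

theorem hasDerivAt_edge_norm2 (n : ℕ) {a : ℝ} (ha : 0 < a) :
    HasDerivAt (norm2 n) (-2 * Real.exp (-a ^ 2) * edge n a ^ 2) a ∧
      HasDerivAt (edge n)
        (2 * (a * edge n a - edge (n + 1) a) - edge n a * auxR n a / a) a ∧
      HasDerivAt (edge (n + 1))
        ((n + 1 + auxR (n + 1) a) * edge n a - edge (n + 1) a * auxR (n + 1) a / a) a := by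
  -- Each step differentiates `norm2_succ` and then `edge_add_two`, so no integral beyond h_0 is
  -- differentiated.
  induction n with
  | zero =>
    have e0 : edge 0 = fun _ => 1 := funext edge_zero
    have e1 : edge 1 = fun t => t := funext edge_one
    refine ⟨?_, ?_, ?_⟩
    · simpa [edge_zero] using hasDerivAt_norm2_zero ha
    · convert! hasDerivAt_const a (1 : ℝ) using 1
      simp [edge_zero, edge_one, auxR_zero]
    · rw [zero_add, e1]
      convert! hasDerivAt_id a using 1
      simp [edge_zero]
      field_simp
      ring
  | succ n ih =>
    obtain ⟨hh, hp, hq⟩ := ih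
    have h0 := (norm2_pos n a).ne'
    have h1 := (norm2_pos (n + 1) a).ne'
    have hE := hasDerivAt_gaussian a
    have hR : auxR (n + 1) a = auxU n a - auxR n a := by
      rw [← auxR_add_auxR_succ]; ring
    have hh' : HasDerivAt (norm2 (n + 1)) (-2 * Real.exp (-a ^ 2) * edge (n + 1) a ^ 2) a := by
      have heq : (fun t => ((n + 1) * norm2 n t +
          2 * Real.exp (-t ^ 2) * edge (n + 1) t * edge n t) / 2) =ᶠ[nhds a] norm2 (n + 1) := by
        filter_upwards [eventually_gt_nhds ha] with t ht
        rw [norm2_succ ht.le]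
      refine HasDerivAt.congr_of_eventuallyEq ?_ heq.symm
      convert! ((hh.const_mul ((n : ℝ) + 1)).add
        (((hE.const_mul 2).mul hq).mul hp)).div_const 2 using 1
      have hr : auxR n a = auxU n a - auxR (n + 1) a := by rw [hR]; ring
      simp only [Pi.mul_apply]
      rw [hr, auxR_succ, auxU]
      field_simp
      ring
    refine ⟨hh', ?_, ?_⟩
    · convert! hq using 1
      have h2 : (n + 1 + auxR (n + 1) a) = 2 * norm2 (n + 1) a / norm2 n a := by
        rw [norm2_succ_eq ha.le]; field_simp
      rw [h2, edge_add_two]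
      ring
    · have e2 : edge (n + 2) =
          fun t => t * edge (n + 1) t - norm2 (n + 1) t / norm2 n t * edge n t :=
        funext fun t => edge_add_two n t
      have hr2 : auxR (n + 2) a = auxU (n + 1) a - auxR (n + 1) a := by
        rw [← auxR_add_auxR_succ]; ring
      -- Solving the norm recursion for n removes n from the goal, leaving a rational identity in
      -- edge values and norms.
      have h2 : (n : ℝ) = 2 * norm2 (n + 1) a / norm2 n a - 1 - auxR (n + 1) a := by
        rw [norm2_succ_eq ha.le]; field_simp; ring
      have hr : auxR n a = auxU n a - auxR (n + 1) a := by rw [hR]; ring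
      rw [show n + 1 + 1 = n + 2 from rfl]
      nth_rewrite 1 [e2]
      convert! ((hasDerivAt_id a).mul hq).sub ((hh'.div hh h0).mul hp) using 1
      push_cast
      rw [hr2, hr, h2, edge_add_two, auxR_succ, auxU, auxU]
      simp only [id, Pi.div_apply]
      field_simp
      ring

theorem hasDerivAt_norm2 (n : ℕ) {a : ℝ} (ha : 0 < a) :
    HasDerivAt (norm2 n) (-2 * Real.exp (-a ^ 2) * edge n a ^ 2) a :=
  (hasDerivAt_edge_norm2 n ha).1

theorem hasDerivAt_auxU (n : ℕ) {a : ℝ} (ha : 0 < a) :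
    HasDerivAt (auxU n) ((auxU n a * (1 - 2 * a ^ 2 - 2 * auxR n a + auxU n a) +
      4 * a ^ 2 * auxR n a) / a) a := by
  obtain ⟨hh, hp, hq⟩ := hasDerivAt_edge_norm2 n ha
  have h0 := (norm2_pos n a).ne'
  convert! ((((hasDerivAt_id a).const_mul 2).mul (hasDerivAt_gaussian a)).mul (hp.pow 2)).div hh h0
    using 1
  simp only [id, auxU, auxR, Pi.mul_apply, Pi.pow_apply]
  field_simp
  ring

theorem hasDerivAt_auxR (n : ℕ) {a : ℝ} (ha : 0 < a) :
    HasDerivAt (auxR n) ((auxC n a - (n + auxR n a) * auxU n a) / a) a := by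
  obtain ⟨hh, hp, hq⟩ := hasDerivAt_edge_norm2 n ha
  have h0 := (norm2_pos n a).ne'
  convert! ((((hasDerivAt_gaussian a).const_mul 2).mul hp).mul
    (((hasDerivAt_id a).mul hp).sub hq)).div hh h0 using 1
  have hR : auxR (n + 1) a = auxU n a - auxR n a := by
    rw [← auxR_add_auxR_succ]; ring
  rw [hR]
  simp only [id, auxU, auxR, auxC, Pi.mul_apply, Pi.sub_apply]
  field_simp
  ring

/-! ### The function σ_n and its first two derivatives -/

theorem hankel_hasDerivAt_log (n : ℕ) {a : ℝ} (ha : 0 < a) :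
    HasDerivAt (fun t => Real.log (hankel n t)) ((-∑ k ∈ Finset.range n, auxU k a) / a) a := by
  have hlog : (fun t => Real.log (hankel n t)) =
      fun t => ∑ k ∈ Finset.range n, Real.log (norm2 k t) := by
    funext t
    rw [hankel_eq_prod, Real.log_prod fun k _ => (norm2_pos k t).ne']
  rw [hlog]
  convert! HasDerivAt.fun_sum fun k _ => (hasDerivAt_norm2 k ha).log (norm2_pos k a).ne' using 1
  rw [← Finset.sum_neg_distrib, Finset.sum_div]
  refine Finset.sum_congr rfl fun k _ => ?_
  rw [auxU]
  field_simp

theorem sigma_eq (n : ℕ) {a : ℝ} (ha : 0 < a) :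
    sigma n a = -∑ k ∈ Finset.range n, auxU k a := by
  rw [sigma, (hankel_hasDerivAt_log n ha).deriv]
  field_simp

theorem sigma_closed (n : ℕ) {a : ℝ} (ha : 0 < a) :
    sigma n a =
      -(n + auxR n a) * auxU n a - auxC n a + 2 * a ^ 2 * auxR n a + auxR n a ^ 2 := by
  rw [sigma_eq n ha, neg_sum_auxU ha.le]

theorem sigma_sub_sigma_succ (n : ℕ) {a : ℝ} (ha : 0 < a) :
    sigma n a - sigma (n + 1) a = auxU n a := by
  rw [sigma_eq n ha, sigma_eq (n + 1) ha, Finset.sum_range_succ]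
  ring

theorem hasDerivAt_sigma (n : ℕ) {a : ℝ} (ha : 0 < a) :
    HasDerivAt (sigma n)
      ((4 * a ^ 2 * auxR n a - auxC n a - (n + auxR n a) * auxU n a) / a) a := by
  have heq : (fun t => -∑ k ∈ Finset.range n, auxU k t) =ᶠ[nhds a] sigma n := by
    filter_upwards [eventually_gt_nhds ha] with t ht
    rw [sigma_eq n ht]
  refine HasDerivAt.congr_of_eventuallyEq ?_ heq.symm
  clear heq
  induction n with
  | zero =>
    simpa [auxR_zero, auxC_zero, auxU, edge_zero] using hasDerivAt_const a (0 : ℝ)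
  | succ n ih =>
    simp only [Finset.sum_range_succ, neg_add]
    convert! ih.add (hasDerivAt_auxU n ha).neg using 1
    have hR : auxR (n + 1) a = auxU n a - auxR n a := by
      rw [← auxR_add_auxR_succ]; ring
    have hC := auxC_succ ha.le n
    have hU := mul_auxU_succ ha.le n
    field_simp
    push_cast
    rw [hR] at hU hC ⊢
    linear_combination -hU - hC

/-- c and (n + R)u enter σ and aσ' with the same coefficients, so they cancel in the difference and
only R remains. -/
theorem deriv_sigma (n : ℕ) {a : ℝ} (ha : 0 < a) :
    deriv (sigma n) a = (sigma n a + 2 * a ^ 2 * auxR n a - auxR n a ^ 2) / a := by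
  rw [(hasDerivAt_sigma n ha).deriv, sigma_closed n ha]
  ring

theorem deriv_deriv_sigma (n : ℕ) {a : ℝ} (ha : 0 < a) :
    a ^ 2 * deriv (deriv (sigma n)) a = 4 * a ^ 2 * auxR n a +
      2 * (a ^ 2 - auxR n a) * (auxC n a - (n + auxR n a) * auxU n a) := by
  have heq : deriv (sigma n) =ᶠ[nhds a]
      fun t => (sigma n t + 2 * t ^ 2 * auxR n t - auxR n t ^ 2) / t := by
    filter_upwards [eventually_gt_nhds ha] with t ht
    exact deriv_sigma n ht
  have hR := hasDerivAt_auxR n ha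
  have hd := ((((hasDerivAt_sigma n ha).add (((hasDerivAt_pow 2 a).const_mul 2).mul hR)).sub
    (hR.pow 2)).div (hasDerivAt_id a) ha.ne').deriv
  rw [heq.deriv_eq]
  refine (congrArg (a ^ 2 * ·) hd).trans ?_
  simp only [id, Pi.add_apply, Pi.sub_apply, Pi.mul_apply, Pi.pow_apply]
  rw [sigma_closed n ha]
  field_simp
  push_cast
  ring

/-! ### The difference and differential equations -/

theorem sigma_difference_equation (n : ℕ) {a : ℝ} (ha : 0 < a) {r s t : ℝ}
    (hr : r = sigma n a) (hs : s = sigma (n + 1) a) (ht : t = sigma (n + 2) a) :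
    ((r - s) * (s - t - 2 * a ^ 2) * ((r - s - 2 * a ^ 2) * (s - t) + 4 * (n + 1) * a ^ 2)
        - 8 * a ^ 4 * (s + (n + 1) * (s - t))) ^ 2
      = (r - s) * (s - t) * (r - s - 2 * a ^ 2) ^ 2 * (s - t - 2 * a ^ 2) ^ 2
        * ((r - s) * (s - t) + 8 * (n + 1) * a ^ 2) := by
  have h1 : r - s = auxU n a := by rw [hr, hs, sigma_sub_sigma_succ n ha]
  have h2 : s - t = auxU (n + 1) a := by rw [hs, ht, sigma_sub_sigma_succ (n + 1) ha]
  have h3 := sigma_closed (n + 1) ha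
  have h4 := auxC_mul_auxU (n + 1) a
  rw [auxC_succ ha.le] at h3 h4
  rw [← hs] at h3
  push_cast at h3
  rw [h1, h2]
  set v := auxU n a
  set u := auxU (n + 1) a
  set R := auxR (n + 1) a
  -- By `h4`, 2a²R² = (n + 1 + R)uv. Reducing R² by this makes the bracket linear in R, and `h6`
  -- completes the square in the same quadratic.
  have h5 : (v * (u - 2 * a ^ 2) * ((v - 2 * a ^ 2) * u + 4 * (n + 1) * a ^ 2)
      - 8 * a ^ 4 * (s + (n + 1) * u)) =
      -(4 * a ^ 2 * R - u * v) * (u - 2 * a ^ 2) * (v - 2 * a ^ 2) := by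
    rw [h3]
    linear_combination (4 * a ^ 2) * h4
  have h6 : (4 * a ^ 2 * R - u * v) ^ 2 = u * v * (u * v + 8 * (n + 1) * a ^ 2) := by
    linear_combination (-8 * a ^ 2) * h4
  rw [h5]
  linear_combination (u - 2 * a ^ 2) ^ 2 * (v - 2 * a ^ 2) ^ 2 * h6

theorem sigma_differential_equation (n : ℕ) {a : ℝ} (ha : 0 < a) {s s₁ s₂ : ℝ}
    (hs : s = sigma n a) (hs₁ : s₁ = deriv (sigma n) a) (hs₂ : s₂ = deriv (deriv (sigma n)) a) :
    16 * (a ^ 2 * s₂ + 4 * (s + 2 * (n : ℝ) * a ^ 2) * (a * s₁ - s - a ^ 4) - 4 * a ^ 4)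
      * (a ^ 4 * s₂ ^ 2 - 4 * a ^ 2 * s₂ * (a * s₁ - s)
          + 4 * (a * s₁ - s - a ^ 4) * (a * s₁ - 2 * s) ^ 2)
      = (a ^ 2 * s₂ ^ 2
          + 4 * (s₁ ^ 2 + 8 * (n : ℝ) * (a * s₁ - s) - 4 * a ^ 2) * (a * s₁ - s - a ^ 4)
          - 16 * a ^ 6) ^ 2 := by
  have h1 := deriv_sigma n ha
  have h1' := (hasDerivAt_sigma n ha).deriv
  have h2 := deriv_deriv_sigma n ha
  have h4 := auxC_mul_auxU n a
  rw [← hs₁] at h1 h1'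
  rw [← hs] at h1
  rw [← hs₂] at h2
  rw [eq_div_iff ha.ne'] at h1 h1'
  set R := auxR n a
  set V := auxC n a - (n + R) * auxU n a with hV
  -- Consequently aσ' − σ − a⁴ = −(R − a²)².
  have hs : s = s₁ * a - 2 * a ^ 2 * R + R ^ 2 := by linear_combination -h1
  -- The squared terms are the sum and the difference of c and (n + R)u, so the left side is 4(n +
  -- R)cu.
  have hc : (4 * a ^ 2 * R - a * s₁) ^ 2 - V ^ 2 = 8 * a ^ 2 * R ^ 2 * (n + R) := by
    have hW : 4 * a ^ 2 * R - a * s₁ = auxC n a + (n + R) * auxU n a := by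
      linear_combination -h1'
    rw [hW, hV]
    linear_combination 4 * (n + R) * h4
  -- The factor a⁴ lets the right side be written in aσ' and a²σ''; the equation then becomes
  -- polynomial in aσ', V, R, n and a, and follows from `hc` alone.
  have ha4 : a ^ 4 ≠ 0 := by positivity
  apply mul_left_cancel₀ ha4
  have hF : a ^ 4 * s₂ ^ 2 = (a ^ 2 * s₂) ^ 2 := by ring
  have hG : a ^ 4 * (a ^ 2 * s₂ ^ 2
          + 4 * (s₁ ^ 2 + 8 * (n : ℝ) * (a * s₁ - s) - 4 * a ^ 2) * (a * s₁ - s - a ^ 4)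
          - 16 * a ^ 6) ^ 2 = ((a ^ 2 * s₂) ^ 2
          + 4 * ((a * s₁) ^ 2 + 8 * (n : ℝ) * a ^ 2 * (a * s₁ - s) - 4 * a ^ 4)
            * (a * s₁ - s - a ^ 4) - 16 * a ^ 8) ^ 2 := by ring
  have hH : 4 * a ^ 2 * s₂ * (a * s₁ - s) = 4 * (a ^ 2 * s₂) * (a * s₁ - s) := by ring
  rw [hG, hF, hH, h2, hs, mul_comm s₁ a]
  generalize a * s₁ = z at hc ⊢
  linear_combination (-(R - a ^ 2) ^ 4 * (16 * z ^ 2 - 16 * V ^ 2 + 128 * a ^ 2 * V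
    + 128 * a ^ 2 * R * z + 128 * a ^ 2 * R ^ 3 - 128 * a ^ 2 * n * R ^ 2 - 256 * a ^ 4
    - 256 * a ^ 4 * z - 512 * a ^ 4 * R ^ 2 + 512 * a ^ 4 * n * R + 512 * a ^ 6 * R
    - 512 * a ^ 6 * n)) * hc

/-! ### Smoothness and the gap probability -/

theorem contDiffOn_norm2_zero : ContDiffOn ℝ ∞ (norm2 0) (Set.Ioi 0) := by
  rw [contDiffOn_infty_iff_deriv_of_isOpen isOpen_Ioi]
  refine ⟨fun a ha => (hasDerivAt_norm2_zero ha).differentiableAt.differentiableWithinAt, ?_⟩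
  refine ContDiffOn.congr (f := fun a : ℝ => -2 * Real.exp (-a ^ 2)) ?_
    fun a ha => (hasDerivAt_norm2_zero ha).deriv
  exact ContDiff.contDiffOn (by fun_prop)

theorem contDiffOn_norm2_edge (n : ℕ) : ContDiffOn ℝ ∞ (norm2 n) (Set.Ioi 0) ∧
    ContDiffOn ℝ ∞ (edge n) (Set.Ioi 0) ∧ ContDiffOn ℝ ∞ (edge (n + 1)) (Set.Ioi 0) := by
  induction n with
  | zero =>
    refine ⟨contDiffOn_norm2_zero, ?_, ?_⟩
    · rw [show edge 0 = fun _ => 1 from funext edge_zero]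
      exact contDiffOn_const
    · rw [show edge (0 + 1) = fun t => t from funext edge_one]
      exact contDiffOn_id
  | succ n ih =>
    obtain ⟨hh, hp, hq⟩ := ih
    have hE : ContDiffOn ℝ ∞ (fun a : ℝ => Real.exp (-a ^ 2)) (Set.Ioi 0) :=
      ContDiff.contDiffOn (by fun_prop)
    have hh' : ContDiffOn ℝ ∞ (norm2 (n + 1)) (Set.Ioi 0) := by
      refine ContDiffOn.congr (f := fun a => ((n + 1) * norm2 n a +
        2 * Real.exp (-a ^ 2) * edge (n + 1) a * edge n a) / 2) ?_
        fun a ha => norm2_succ (le_of_lt ha) n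
      exact ((contDiffOn_const.mul hh).add
        (((contDiffOn_const.mul hE).mul hq).mul hp)).div_const 2
    refine ⟨hh', hq, ?_⟩
    rw [show edge (n + 1 + 1) = _ from funext fun t => edge_add_two n t]
    exact (contDiffOn_id.mul hq).sub ((hh'.div hh fun a _ => (norm2_pos n a).ne').mul hp)

theorem contDiffOn_auxU (n : ℕ) : ContDiffOn ℝ ∞ (auxU n) (Set.Ioi 0) := by
  obtain ⟨hh, hp, -⟩ := contDiffOn_norm2_edge n
  have hE : ContDiffOn ℝ ∞ (fun a : ℝ => 2 * a * Real.exp (-a ^ 2)) (Set.Ioi 0) :=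
    ContDiff.contDiffOn (by fun_prop)
  exact (hE.mul (hp.pow 2)).div hh fun a _ => (norm2_pos n a).ne'

theorem contDiffOn_sigma (n : ℕ) : ContDiffOn ℝ ∞ (sigma n) (Set.Ioi 0) :=
  (ContDiffOn.sum fun k _ => contDiffOn_auxU k).neg.congr fun _ ha => by
    rw [sigma_eq n ha]

theorem differentiableOn_hankel (n : ℕ) : DifferentiableOn ℝ (hankel n) (Set.Ioi 0) := by
  rw [show hankel n = _ from funext fun a => hankel_eq_prod n a]
  exact DifferentiableOn.fun_finsetProd fun k _ a ha =>
    (hasDerivAt_norm2 k ha).differentiableAt.differentiableWithinAt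

theorem sigma_eq_log_gapProb (n : ℕ) (a : ℝ) :
    sigma n a = a * deriv (fun t : ℝ => Real.log (gapProb n t)) a := by
  have h : (fun t : ℝ => Real.log (gapProb n t)) =
      fun t => Real.log (hankel n t) - Real.log (hankel n 0) := by
    funext t
    rw [gapProb_eq, Real.log_div (hankel_pos n t).ne' (hankel_pos n 0).ne']
  rw [h, deriv_sub_const, sigma]

end GUEGap
theorem mainTheorem8 :
    -- `D_n` is positive and the gap probability is `D_n(a) / D_n(0)`
    (∀ (n : ℕ) (a : ℝ), 0 ≤ a →
      0 < GUEGap.hankel n a ∧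
      GUEGap.gapProb n a = GUEGap.hankel n a / GUEGap.hankel n 0) ∧
    -- the derivatives below exist, and `σ_n = a d/da log P(a,n)`
    (∀ n : ℕ,
      DifferentiableOn ℝ (GUEGap.hankel n) (Set.Ioi 0) ∧
      ContDiffOn ℝ ∞ (GUEGap.sigma n) (Set.Ioi 0) ∧
      ∀ a : ℝ, 0 < a →
        GUEGap.sigma n a = a * deriv (fun t : ℝ => Real.log (GUEGap.gapProb n t)) a) ∧
    -- the second order difference equation, with `r = σ_{n-1}`, `s = σ_n`, `t = σ_{n+1}`
    (∀ (n : ℕ), 1 ≤ n → ∀ a : ℝ, 0 < a → ∀ r s t : ℝ,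
      r = GUEGap.sigma (n - 1) a → s = GUEGap.sigma n a → t = GUEGap.sigma (n + 1) a →
      ((r - s) * (s - t - 2 * a ^ 2) * ((r - s - 2 * a ^ 2) * (s - t) + 4 * (n : ℝ) * a ^ 2)
          - 8 * a ^ 4 * (s + (n : ℝ) * (s - t))) ^ 2
        = (r - s) * (s - t) * (r - s - 2 * a ^ 2) ^ 2 * (s - t - 2 * a ^ 2) ^ 2
          * ((r - s) * (s - t) + 8 * (n : ℝ) * a ^ 2)) ∧
    -- the differential equation, with `s = σ_n(a)`, `s₁ = σ_n'(a)`, `s₂ = σ_n''(a)`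
    (∀ (n : ℕ) (a : ℝ), 0 < a → ∀ s s₁ s₂ : ℝ,
      s = GUEGap.sigma n a → s₁ = deriv (GUEGap.sigma n) a →
      s₂ = deriv (deriv (GUEGap.sigma n)) a →
      16 * (a ^ 2 * s₂ + 4 * (s + 2 * (n : ℝ) * a ^ 2) * (a * s₁ - s - a ^ 4) - 4 * a ^ 4)
        * (a ^ 4 * s₂ ^ 2 - 4 * a ^ 2 * s₂ * (a * s₁ - s)
            + 4 * (a * s₁ - s - a ^ 4) * (a * s₁ - 2 * s) ^ 2)
        = (a ^ 2 * s₂ ^ 2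
            + 4 * (s₁ ^ 2 + 8 * (n : ℝ) * (a * s₁ - s) - 4 * a ^ 2) * (a * s₁ - s - a ^ 4)
            - 16 * a ^ 6) ^ 2) := by
  refine ⟨fun n a _ => ⟨GUEGap.hankel_pos n a, GUEGap.gapProb_eq n a⟩,
    fun n => ⟨GUEGap.differentiableOn_hankel n, GUEGap.contDiffOn_sigma n,
      fun a _ => GUEGap.sigma_eq_log_gapProb n a⟩, fun n hn a ha r s t hr hs ht => ?_,
    fun n a ha s s₁ s₂ hs hs₁ hs₂ => GUEGap.sigma_differential_equation n ha hs hs₁ hs₂⟩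
  obtain ⟨m, rfl⟩ := Nat.exists_eq_add_of_le' hn
  push_cast
  exact GUEGap.sigma_difference_equation m ha hr hs ht
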